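/- Let $n\ge 3$, let $G=K_n$ be the complete graph of order $n$, let $G_1,G_2$ be two disjoint copies of $G$ and let $g:V(G_1)\to V(G_2)$ be a function. The functigraph $F_G$ has vertex set $V(G_1)\cup V(G_2)$ and edge set $E(G_1)\cup E(G_2)\cup\{uv : u\in V(G_1),\ v\in V(G_2),\ g(u)=v\}$. The distinguishing number $\mathrm{Dist}(H)$ of a finite graph $H$ is the least $t$ for which there is a labeling $V(H)\to\{1,\dots,t\}$ that is preserved by no non-trivial automorphism of $H$. Let $I=g(V(G_1))$ and $s=|I|$, let $l=\max_{v\in I}|g^{-1}(v)|$ be the largest fibre size, and let $m$ be the number of $v\in I$ with exactly one preimage under $g$. For an integer $m\ge 0$ let $\psi(m)$ be the least integer $k\ge 0$ with $m\le 2\binom{k}{2}+k=k^2$. If $1<s\le n-1$, then $\mathrm{Dist}(F_G)=n-s$, or $\mathrm{Dist}(F_G)=n-s+1$, or $m\ge 2$ and $\mathrm{Dist}(F_G)=\psi(m)$. More precisely, $$\mathrm{Dist}(F_G)=\begin{cases}\max\{n-s+1,\psi(m)\} & \text{if } l=n-s+1,\\ \max\{n-s,\psi(m)\} & \text{if } l\ne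 n-s+1.\end{cases}$$ -/

import Mathlib

/-- The functigraph `F_G` of a graph `G` with respect to `g`: two disjoint copies of `G`
(the left summand is the first copy, the right summand the second one), together with an edge
from each vertex `u` of the first copy to the vertex `g u` of the second copy. -/
def functigraph {V : Type*} (G : SimpleGraph V) (g : V → V) : SimpleGraph (V ⊕ V) where
  Adj
    | Sum.inl u, Sum.inl v => G.Adj u v
    | Sum.inr u, Sum.inr v => G.Adj u v
    | Sum.inl u, Sum.inr v => g u = v
    | Sum.inr v, Sum.inl u => g u = v
  symm := ⟨by
    rintro (u | u) (v | v) h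
    · exact G.adj_symm h
    · exact h
    · exact h
    · exact G.adj_symm h⟩
  loopless := ⟨by
    rintro (u | u) h
    · exact G.loopless.irrefl u h
    · exact G.loopless.irrefl u h⟩

/-- A vertex labeling is distinguishing if no non-trivial automorphism preserves the labels. -/
def IsDistinguishing {W L : Type*} (H : SimpleGraph W) (f : W → L) : Prop :=
  ∀ φ : H ≃g H, (∀ w, f (φ w) = f w) → ∀ w, φ w = w

/-- The distinguishing number: the least `t` such that there is a distinguishing labeling with
`t` labels. (Such a `t` exists for every graph with finitely many vertices.) -/
noncomputable def distinguishingNumber {W : Type*} (H : SimpleGraph W) : ℕ :=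
  sInf {t : ℕ | ∃ f : W → Fin t, IsDistinguishing H f}

/-- `ψ(m)`: the least `k` such that `m ≤ 2 * (k choose 2) + k`. -/
noncomputable def psi (m : ℕ) : ℕ := sInf {k : ℕ | m ≤ 2 * k.choose 2 + k}

section Fibres

variable {V : Type*} [Fintype V] [DecidableEq V]

/-- The image of `g`, as a finite set. -/
def imageSet (g : V → V) : Finset V := Finset.univ.image g

/-- The number of vertices that `g` maps to `v`. -/
def fibreSize (g : V → V) (v : V) : ℕ := (Finset.univ.filter fun u => g u = v).card

/-- The largest size of a fibre over a vertex of the image. -/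
def maxFibreSize (g : V → V) : ℕ := (imageSet g).sup (fibreSize g)

/-- The number of vertices in the image that have exactly one preimage. -/
def singletonFibres (g : V → V) : ℕ := ((imageSet g).filter fun v => fibreSize g v = 1).card

end Fibres

/-! The vertices of the second copy outside `range g` are exactly the simplicial vertices (those
whose neighbours form a clique) of the functigraph of a complete graph, as long as `g` is neither
constant nor surjective. So every automorphism preserves both copies and is a pair of permutations
`σ`, `τ` with `g ∘ σ = τ ∘ g`. Three kinds of transpositions are of this form: of two vertices in a
common fibre, of two vertices outside the image, and of two singleton fibres together with their
image points. Killing them takes at least `l`, `n - s` and `√m` labels respectively. Conversely, a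
labeling which kills them and separates the points with more than one preimage is distinguishing,
and there are at most `n - s` such points. -/

open Function Set

section Psi

theorem two_mul_choose_two_add_self (k : ℕ) : 2 * k.choose 2 + k = k * k := by
  rw [Nat.choose_two_right, Nat.mul_div_cancel' (Nat.even_mul_pred_self k).two_dvd, Nat.mul_sub_one,
    Nat.sub_add_cancel (Nat.le_mul_self k)]

theorem psi_le_iff {m k : ℕ} : psi m ≤ k ↔ m ≤ k * k := by
  simp only [psi, two_mul_choose_two_add_self]
  refine ⟨fun h => ?_, fun h => Nat.sInf_le h⟩
  have hmem : sInf {k : ℕ | m ≤ k * k} ∈ {k : ℕ | m ≤ k * k} :=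
    Nat.sInf_mem ⟨m, Nat.le_mul_self m⟩
  exact hmem.trans (Nat.mul_le_mul h h)

end Psi

section DistinguishingNumber

variable {W L L' : Type*} {H : SimpleGraph W}

theorem isDistinguishing_of_injective {f : W → L} (hf : Injective f) : IsDistinguishing H f :=
  fun _ hφ w => hf (hφ w)

theorem IsDistinguishing.comp_injective {f : W → L} (hf : IsDistinguishing H f) {e : L → L'}
    (he : Injective e) : IsDistinguishing H (e ∘ f) :=
  fun φ hφ => hf φ fun w => he (hφ w)

theorem distinguishingNumber_le_iff [Finite W] {k : ℕ} :
    distinguishingNumber H ≤ k ↔ ∃ f : W → Fin k, IsDistinguishing H f := by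
  refine ⟨fun h => ?_, fun h => Nat.sInf_le h⟩
  have hne : {t : ℕ | ∃ f : W → Fin t, IsDistinguishing H f}.Nonempty :=
    ⟨_, Finite.equivFin W, isDistinguishing_of_injective (Finite.equivFin W).injective⟩
  obtain ⟨f, hf⟩ := Nat.sInf_mem hne
  exact ⟨_, hf.comp_injective (Fin.castLE_injective h)⟩

end DistinguishingNumber

theorem exists_injOn_iff_ncard_le {α β : Type*} [Finite α] [Finite β] [Nonempty β] {s : Set α} :
    (∃ f : α → β, InjOn f s) ↔ s.ncard ≤ Nat.card β := by
  rw [exists_injOn_iff_injective, ← Nat.card_coe_set_eq]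
  refine ⟨fun ⟨f, hf⟩ => Nat.card_le_card_of_injective f hf, fun h => ?_⟩
  have := Fintype.ofFinite s
  have := Fintype.ofFinite β
  simp only [Nat.card_eq_fintype_card] at h
  obtain ⟨e⟩ := Embedding.nonempty_of_card_le h
  exact ⟨e, e.injective⟩

section Fibre

variable {α β : Type*} {g : α → β}

/-- The points that are alone in their fibre under `g`. The function `g` maps them bijectively onto
the points with exactly one preimage, so for the functigraph there are `m` of them. -/
def lonePoints (g : α → β) : Set α := {u | (g ⁻¹' {g u}).Subsingleton}

theorem eq_of_mem_lonePoints {u x : α} (hu : u ∈ lonePoints g) (h : g x = g u) : x = u :=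
  hu h rfl

theorem injOn_lonePoints : InjOn g (lonePoints g) :=
  fun _ _ _ hu' h => eq_of_mem_lonePoints hu' h

theorem preimage_singleton_of_semiconj {σ : Equiv.Perm α} {τ : Equiv.Perm β}
    (h : Semiconj g σ τ) (v : β) : g ⁻¹' {τ v} = σ '' (g ⁻¹' {v}) := by
  ext x
  obtain ⟨u, rfl⟩ := σ.surjective x
  simp [h.eq]

theorem ncard_compl_range_rangeSplitting [Finite α] :
    (range (rangeSplitting g))ᶜ.ncard = Nat.card α - (range g).ncard := by
  rw [ncard_compl, ncard_range_of_injective (rangeSplitting_injective g), Nat.card_coe_set_eq]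

theorem rangeSplitting_apply_of_mem_range {u : α} (hu : u ∈ range (rangeSplitting g)) :
    rangeSplitting g ⟨g u, mem_range_self u⟩ = u := by
  obtain ⟨y, rfl⟩ := hu
  exact congrArg _ (Subtype.ext (apply_rangeSplitting g y))

theorem ncard_setOf_nontrivial_fibre_le [Finite α] :
    {v | (g ⁻¹' {v}).Nontrivial}.ncard ≤ Nat.card α - (range g).ncard := by
  rw [← ncard_compl_range_rangeSplitting]
  refine (ncard_le_ncard fun v hv => ?_).trans (ncard_image_le (f := g))
  obtain ⟨w, rfl⟩ := hv.nonempty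
  obtain ⟨u, hu, hne⟩ := hv.exists_ne (rangeSplitting g ⟨g w, mem_range_self w⟩)
  refine ⟨u, fun hmem => hne ?_, hu⟩
  simpa only [eq_of_mem_singleton hu] using (rangeSplitting_apply_of_mem_range hmem).symm

theorem ncard_fibre_le [Finite α] (v : β) :
    (g ⁻¹' {v}).ncard ≤ Nat.card α - (range g).ncard + 1 := by
  rw [← ncard_compl_range_rangeSplitting]
  rcases (g ⁻¹' {v}).eq_empty_or_nonempty with hv | ⟨w, rfl⟩
  · simp [hv]
  refine (ncard_le_ncard fun u hu => ?_).trans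
    (ncard_insert_le (rangeSplitting g ⟨g w, mem_range_self w⟩) _)
  refine or_iff_not_imp_left.2 fun hne hmem => hne ?_
  simpa only [eq_of_mem_singleton hu] using (rangeSplitting_apply_of_mem_range hmem).symm

end Fibre

theorem isClique_neighborSet_apply_iff {W W' : Type*} {G : SimpleGraph W} {H : SimpleGraph W'}
    (φ : G ≃g H) {x : W} :
    H.IsClique (H.neighborSet (φ x)) ↔ G.IsClique (G.neighborSet x) := by
  rw [← φ.image_neighborSet, SimpleGraph.IsClique, φ.injective.injOn.pairwise_image]
  exact ⟨fun h a ha b hb hab => φ.map_adj_iff.1 (h ha hb hab),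
    fun h a ha b hb hab => φ.map_adj_iff.2 (h ha hb hab)⟩

section Automorphisms

variable {V : Type*} {g : V → V}

/-- The automorphism of the functigraph that acts as `σ` on the first copy of the graph and as `τ`
on the second one. -/
def functigraphIso {G : SimpleGraph V} (σ τ : G ≃g G) (h : Semiconj g σ τ) :
    functigraph G g ≃g functigraph G g where
  toEquiv := σ.toEquiv.sumCongr τ.toEquiv
  map_rel_iff' := by
    rintro (u | u) (v | v) <;> simp [functigraph, h.eq, σ.map_adj_iff, τ.map_adj_iff]

theorem isClique_neighborSet_functigraph_top_iff (hg : (range g).Nontrivial) {x : V ⊕ V} :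
    (functigraph ⊤ g).IsClique ((functigraph ⊤ g).neighborSet x) ↔
      x ∈ Sum.inr '' (range g)ᶜ := by
  rcases x with u | v
  · obtain ⟨_, ⟨u', rfl⟩, hu'⟩ := hg.exists_ne (g u)
    have hadj : (functigraph ⊤ g).Adj (Sum.inl u) (Sum.inl u') := fun h => hu' (h ▸ rfl)
    have hadj' : (functigraph ⊤ g).Adj (Sum.inl u) (Sum.inr (g u)) := rfl
    simpa using fun h => hu' (h hadj hadj' Sum.inl_ne_inr)
  · simp only [Sum.inr_injective.mem_set_image, mem_compl_iff]
    refine ⟨?_, ?_⟩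
    · rintro h ⟨u, rfl⟩
      obtain ⟨y, -, hy⟩ := hg.exists_ne (g u)
      have hadj : (functigraph ⊤ g).Adj (Sum.inr (g u)) (Sum.inl u) := rfl
      have hadj' : (functigraph ⊤ g).Adj (Sum.inr (g u)) (Sum.inr y) := hy.symm
      exact hy.symm (h hadj hadj' Sum.inl_ne_inr)
    · rintro hv (a | a) ha (b | b) hb hab
      · exact absurd ⟨a, ha⟩ hv
      · exact absurd ⟨a, ha⟩ hv
      · exact absurd ⟨b, hb⟩ hv
      · exact fun h => hab (congrArg _ h)

theorem exists_apply_inr_eq_inr (hg : (range g).Nontrivial) (hsurj : ¬ Surjective g)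
    (φ : functigraph (⊤ : SimpleGraph V) g ≃g functigraph (⊤ : SimpleGraph V) g) (v : V) :
    ∃ v', φ (Sum.inr v) = Sum.inr v' := by
  obtain ⟨w, hw⟩ := not_forall.1 hsurj
  obtain ⟨w', hw', hφw⟩ : φ (Sum.inr w) ∈ Sum.inr '' (range g)ᶜ := by
    rw [← isClique_neighborSet_functigraph_top_iff hg, isClique_neighborSet_apply_iff,
      isClique_neighborSet_functigraph_top_iff hg]
    exact mem_image_of_mem _ hw
  rcases eq_or_ne v w with rfl | hvw
  · exact ⟨w', hφw.symm⟩
  · have hadj : (functigraph ⊤ g).Adj (φ (Sum.inr v)) (Sum.inr w') := by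
      rw [hφw, φ.map_adj_iff]
      exact hvw
    rcases hφv : φ (Sum.inr v) with u | v'
    · rw [hφv] at hadj
      exact absurd ⟨u, hadj⟩ hw'
    · exact ⟨v', rfl⟩

theorem exists_semiconj_of_functigraph_top_iso [Finite V] (hg : (range g).Nontrivial)
    (hsurj : ¬ Surjective g)
    (φ : functigraph (⊤ : SimpleGraph V) g ≃g functigraph (⊤ : SimpleGraph V) g) :
    ∃ σ τ : Equiv.Perm V, Semiconj g σ τ ∧ ∀ x, φ x = Sum.map σ τ x := by
  have hinl : MapsTo φ.toEquiv (range Sum.inl) (range Sum.inl) := by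
    rintro _ ⟨u, rfl⟩
    rcases hφu : φ (Sum.inl u) with u' | v
    · exact ⟨u', rfl⟩
    · obtain ⟨v', hv'⟩ := exists_apply_inr_eq_inr hg hsurj φ.symm v
      rw [← hφu, φ.symm_apply_apply] at hv'
      exact absurd hv' Sum.inl_ne_inr
  obtain ⟨⟨σ, τ⟩, hφ⟩ := Equiv.Perm.mem_sumCongrHom_range_of_perm_mapsTo_inl hinl
  have hφ' : ∀ x, φ x = Sum.map σ τ x := fun x => (DFunLike.congr_fun hφ x).symm
  refine ⟨σ, τ, fun u => ?_, hφ'⟩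
  have hadj : (functigraph ⊤ g).Adj (φ (Sum.inl u)) (φ (Sum.inr (g u))) := φ.map_adj_iff.2 rfl
  rwa [hφ', hφ'] at hadj

end Automorphisms

section Labelings

variable {V L : Type*} {g : V → V} {f : V ⊕ V → L}

theorem IsDistinguishing.perm_eq_one (hf : IsDistinguishing (functigraph ⊤ g) f)
    {σ τ : Equiv.Perm V} (h : Semiconj g σ τ) (hσ : ∀ u, f (Sum.inl (σ u)) = f (Sum.inl u))
    (hτ : ∀ v, f (Sum.inr (τ v)) = f (Sum.inr v)) : σ = 1 ∧ τ = 1 := by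
  have hfix := hf (functigraphIso (.completeGraph σ) (.completeGraph τ) h) (Sum.rec hσ hτ)
  exact ⟨Equiv.ext fun u => Sum.inl_injective (hfix (Sum.inl u)),
    Equiv.ext fun v => Sum.inr_injective (hfix (Sum.inr v))⟩

theorem IsDistinguishing.injOn_inl_fibre (hf : IsDistinguishing (functigraph ⊤ g) f) (v : V) :
    InjOn (f ∘ Sum.inl) (g ⁻¹' {v}) := by
  classical
  intro u hu u' hu' hlabel
  have hg : g u = g u' := hu.trans hu'.symm
  have hsemi : Semiconj g (Equiv.swap u u') (1 : Equiv.Perm V) := Equiv.apply_swap_eq_self hg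
  exact Equiv.swap_eq_one_iff.1
    (hf.perm_eq_one hsemi (Equiv.apply_swap_eq_self hlabel) fun _ => rfl).1

theorem IsDistinguishing.injOn_inr_compl_range (hf : IsDistinguishing (functigraph ⊤ g) f) :
    InjOn (f ∘ Sum.inr) (range g)ᶜ := by
  classical
  intro v hv v' hv' hlabel
  have hsemi : Semiconj g (1 : Equiv.Perm V) (Equiv.swap v v') := fun u =>
    (Equiv.swap_apply_of_ne_of_ne (fun h => hv ⟨u, h⟩) (fun h => hv' ⟨u, h⟩)).symm
  exact Equiv.swap_eq_one_iff.1
    (hf.perm_eq_one hsemi (fun _ => rfl) (Equiv.apply_swap_eq_self hlabel)).2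

theorem IsDistinguishing.injOn_lonePoints (hf : IsDistinguishing (functigraph ⊤ g) f) :
    InjOn (fun u => (f (Sum.inl u), f (Sum.inr (g u)))) (lonePoints g) := by
  classical
  intro u hu u' hu' hlabel
  have hsemi : Semiconj g (Equiv.swap u u') (Equiv.swap (g u) (g u')) := by
    intro x
    have := @eq_of_mem_lonePoints _ _ _ _ x hu
    have := @eq_of_mem_lonePoints _ _ _ _ x hu'
    grind
  obtain ⟨hinl, hinr⟩ := Prod.ext_iff.1 hlabel
  exact Equiv.swap_eq_one_iff.1 (hf.perm_eq_one hsemi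
    (Equiv.apply_swap_eq_self (v := f ∘ Sum.inl) hinl)
    (Equiv.apply_swap_eq_self (v := f ∘ Sum.inr) hinr)).1

theorem isDistinguishing_functigraph_top_of_injOn [Finite V] (hg : (range g).Nontrivial)
    (hsurj : ¬ Surjective g) (hcompl : InjOn (f ∘ Sum.inr) (range g)ᶜ)
    (hlone : InjOn (fun u => (f (Sum.inl u), f (Sum.inr (g u)))) (lonePoints g))
    (hmulti : InjOn (f ∘ Sum.inr) {v | (g ⁻¹' {v}).Nontrivial})
    (hfibre : ∀ v, InjOn (f ∘ Sum.inl) (g ⁻¹' {v})) :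
    IsDistinguishing (functigraph ⊤ g) f := by
  intro φ hφ
  obtain ⟨σ, τ, hsemi, hφστ⟩ := exists_semiconj_of_functigraph_top_iso hg hsurj φ
  have hσ : ∀ u, f (Sum.inl (σ u)) = f (Sum.inl u) := by simpa [hφστ] using fun u => hφ (.inl u)
  have hτ : ∀ v, f (Sum.inr (τ v)) = f (Sum.inr v) := by simpa [hφστ] using fun v => hφ (.inr v)
  have hpre := preimage_singleton_of_semiconj hsemi
  have hτ_id : ∀ v, τ v = v := by
    intro v
    by_cases hv : v ∈ range g
    · obtain ⟨u, rfl⟩ := hv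
      rcases (g ⁻¹' {g u}).subsingleton_or_nontrivial with hu | hu
      · have hσu : (g ⁻¹' {g (σ u)}).Subsingleton := by
          rw [hsemi.eq, hpre]
          exact hu.image σ
        rw [← hsemi.eq, hlone hσu hu (by simp [hσ, hsemi.eq, hτ])]
      · refine hmulti ?_ hu (hτ _)
        rw [mem_ofPred_eq, hpre]
        exact hu.image σ.injective
    · refine hcompl ?_ hv (hτ v)
      rwa [mem_compl_iff, ← preimage_singleton_nonempty, hpre, image_nonempty,
        preimage_singleton_nonempty]
  have hσ_id : ∀ u, σ u = u := fun u =>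
    hfibre (g u) ((hsemi.eq u).trans (hτ_id _)) rfl (hσ u)
  rintro (u | v) <;> simp [hφστ, hσ_id, hτ_id]

theorem exists_isDistinguishing_functigraph_top [Finite V] [Finite L] [Nonempty L]
    (hg : (range g).Nontrivial) (hsurj : ¬ Surjective g)
    (hcompl : (range g)ᶜ.ncard ≤ Nat.card L) (hfibre : ∀ v, (g ⁻¹' {v}).ncard ≤ Nat.card L)
    (hlone : (lonePoints g).ncard ≤ Nat.card L * Nat.card L) :
    ∃ f : V ⊕ V → L, IsDistinguishing (functigraph ⊤ g) f := by
  classical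
  obtain ⟨a, ha⟩ := exists_injOn_iff_ncard_le.2 hcompl
  obtain ⟨b, hb⟩ := exists_injOn_iff_ncard_le.2 <|
    ncard_setOf_nontrivial_fibre_le.trans (ncard_compl (range g) ▸ hcompl)
  choose c hc using fun v => exists_injOn_iff_ncard_le.2 (hfibre v)
  obtain ⟨p, hp⟩ : ∃ p : V → L × L, InjOn p (g '' lonePoints g) := by
    rwa [exists_injOn_iff_ncard_le, Nat.card_prod, injOn_lonePoints.ncard_image]
  refine ⟨Sum.elim
    (fun u => if u ∈ lonePoints g then (p (g u)).1 else c (g u) u)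
    (fun v => if (g ⁻¹' {v}).Nontrivial then b v else if v ∈ range g then (p v).2 else a v),
    isDistinguishing_functigraph_top_of_injOn hg hsurj ?_ ?_ ?_ fun v => ?_⟩
  · refine ha.congr fun v hv => ?_
    have hv' : ¬ (g ⁻¹' {v}).Nontrivial := fun h => hv (preimage_singleton_nonempty.1 h.nonempty)
    rw [comp_apply, Sum.elim_inr, if_neg hv', if_neg hv]
  · refine (hp.comp injOn_lonePoints (mapsTo_image _ _)).congr fun u hu => ?_
    have hu' : ¬ (g ⁻¹' {g u}).Nontrivial := not_nontrivial_iff.2 hu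
    simp [hu, hu']
  · exact hb.congr fun v hv => (if_pos hv).symm
  · rcases (g ⁻¹' {v}).subsingleton_or_nontrivial with hv | hv
    · exact hv.injOn _
    · refine (hc v).congr fun u hu => ?_
      obtain rfl : g u = v := hu
      have hu' : u ∉ lonePoints g := not_subsingleton_iff.2 hv
      simp [hu']

theorem exists_isDistinguishing_functigraph_top_iff [Finite V] [Finite L]
    (hg : (range g).Nontrivial) (hsurj : ¬ Surjective g) :
    (∃ f : V ⊕ V → L, IsDistinguishing (functigraph ⊤ g) f) ↔
      (range g)ᶜ.ncard ≤ Nat.card L ∧ (∀ v, (g ⁻¹' {v}).ncard ≤ Nat.card L) ∧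
        (lonePoints g).ncard ≤ Nat.card L * Nat.card L := by
  obtain ⟨_, ⟨u, rfl⟩⟩ := hg.nonempty
  constructor
  · rintro ⟨f, hf⟩
    have : Nonempty L := ⟨f (Sum.inl u)⟩
    rw [← Nat.card_prod]
    exact ⟨exists_injOn_iff_ncard_le.1 ⟨_, hf.injOn_inr_compl_range⟩,
      fun v => exists_injOn_iff_ncard_le.1 ⟨_, hf.injOn_inl_fibre v⟩,
      exists_injOn_iff_ncard_le.1 ⟨_, hf.injOn_lonePoints⟩⟩
  · rintro ⟨hcompl, hfibre, hlone⟩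
    have hpos : 0 < (g ⁻¹' {g u}).ncard := (ncard_pos (toFinite _)).2 ⟨u, rfl⟩
    have : Nonempty L := (Nat.card_pos_iff.1 (hpos.trans_le (hfibre _))).1
    exact exists_isDistinguishing_functigraph_top hg hsurj hcompl hfibre hlone

end Labelings

section Parameters

variable {V : Type*} [Fintype V] [DecidableEq V] (g : V → V)

theorem coe_imageSet : (imageSet g : Set V) = range g := by
  simp [imageSet]

theorem card_imageSet : (imageSet g).card = (range g).ncard := by
  rw [← coe_imageSet, ncard_coe_finset]

theorem fibreSize_eq_ncard (v : V) : fibreSize g v = (g ⁻¹' {v}).ncard := by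
  rw [fibreSize, ← ncard_coe_finset, Finset.coe_filter_univ]
  rfl

theorem fibreSize_apply_eq_one_iff {u : V} : fibreSize g (g u) = 1 ↔ u ∈ lonePoints g := by
  have hpos : 0 < (g ⁻¹' {g u}).ncard := (ncard_pos (toFinite _)).2 ⟨u, rfl⟩
  rw [fibreSize_eq_ncard, lonePoints, mem_ofPred_eq, ← ncard_le_one_iff_subsingleton]
  lia

theorem maxFibreSize_le_iff {k : ℕ} : maxFibreSize g ≤ k ↔ ∀ v, (g ⁻¹' {v}).ncard ≤ k := by
  simp only [maxFibreSize, Finset.sup_le_iff, ← Finset.mem_coe, coe_imageSet, fibreSize_eq_ncard]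
  refine ⟨fun h v => ?_, fun h v _ => h v⟩
  by_cases hv : v ∈ range g
  · exact h v hv
  · simp [preimage_singleton_eq_empty.2 hv]

theorem maxFibreSize_le : maxFibreSize g ≤ Fintype.card V - (imageSet g).card + 1 := by
  rw [maxFibreSize_le_iff, card_imageSet, ← Nat.card_eq_fintype_card]
  exact ncard_fibre_le

theorem singletonFibres_eq_ncard : singletonFibres g = (lonePoints g).ncard := by
  have hlone : {u | fibreSize g (g u) = 1} = lonePoints g :=
    Set.ext fun _ => fibreSize_apply_eq_one_iff g
  rw [singletonFibres, imageSet, Finset.filter_image, ← ncard_coe_finset, Finset.coe_image,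
    Finset.coe_filter_univ, hlone, injOn_lonePoints.ncard_image]

variable {g}

theorem distinguishingNumber_functigraph_top (hg : (range g).Nontrivial)
    (hsurj : ¬ Surjective g) :
    distinguishingNumber (functigraph (⊤ : SimpleGraph V) g) =
      max (Fintype.card V - (imageSet g).card)
        (max (maxFibreSize g) (psi (singletonFibres g))) := by
  refine eq_of_forall_ge_iff fun k => ?_
  rw [distinguishingNumber_le_iff, exists_isDistinguishing_functigraph_top_iff hg hsurj,
    max_le_iff, max_le_iff, psi_le_iff, maxFibreSize_le_iff, singletonFibres_eq_ncard,
    card_imageSet, ncard_compl, Nat.card_eq_fintype_card, Nat.card_eq_fintype_card,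
    Fintype.card_fin]

end Parameters

theorem theorem3p3 {V : Type*} [Fintype V] [DecidableEq V] (g : V → V) (n s l m : ℕ)
    (hn : n = Fintype.card V) (hs : s = (imageSet g).card)
    (hl : l = maxFibreSize g) (hm : m = singletonFibres g)
    (hn3 : 3 ≤ n) (hs1 : 1 < s) (hsn : s ≤ n - 1) :
    (distinguishingNumber (functigraph (⊤ : SimpleGraph V) g) = n - s ∨
      distinguishingNumber (functigraph (⊤ : SimpleGraph V) g) = n - s + 1 ∨
      (2 ≤ m ∧ distinguishingNumber (functigraph (⊤ : SimpleGraph V) g) = psi m)) ∧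
    (l = n - s + 1 →
      distinguishingNumber (functigraph (⊤ : SimpleGraph V) g) = max (n - s + 1) (psi m)) ∧
    (l ≠ n - s + 1 →
      distinguishingNumber (functigraph (⊤ : SimpleGraph V) g) = max (n - s) (psi m)) := by
  have hg : (range g).Nontrivial := by
    rw [← coe_imageSet]
    exact Finset.one_lt_card_iff_nontrivial.1 (hs ▸ hs1)
  have hsurj : ¬ Surjective g := by
    intro h
    have himage : imageSet g = Finset.univ := Finset.image_univ_of_surjective h
    rw [himage, Finset.card_univ] at hs
    lia
  have hle : l ≤ n - s + 1 := hl ▸ hn ▸ hs ▸ maxFibreSize_le g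
  have hpsi : m < 2 → psi m ≤ 1 := fun h => psi_le_iff.2 (by lia)
  rw [distinguishingNumber_functigraph_top hg hsurj, ← hn, ← hs, ← hl, ← hm]
  refine ⟨?_, ?_, ?_⟩ <;> lia
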